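/- Theorem 4.1. Let $U$ be a $2\times 2$ complex unitary matrix with rows and columns indexed by $R,L$, and put $a=U_{RR}$, $b=U_{RL}$ (for example $U=\begin{bmatrix} a & b\\ -\bar b & \bar a\end{bmatrix}$ with $|a|^2+|b|^2=1$); assume $b\neq 0$. On $\ell^2(\mathbb Z\times\{R,L\})$, with $R=+1$ and $L=-1$, let $Q=T(I\otimes U)$, where $T|g\rangle|\sigma\rangle=|g+\sigma\rangle|\sigma\rangle$ and $U|\tau\rangle=\sum_\sigma U_{\sigma\tau}|\sigma\rangle$, and let $\Pi$ be the orthogonal projection onto the states that vanish at position $0$. Let $$P_\infty^{(1)}(1,0)=\sum_{t=1}^\infty\ \sum_{\sigma\in\{R,L\}}\bigl|\langle 0,\sigma|\,Q(\Pi Q)^{t-1}\,|1,R\rangle\bigr|^2$$ be the probability that the walk started at $|1\rangle|R\rangle$ is eventually absorbed at $0$. Then this series converges and $$P_\infty^{(1)}(1,0)=\frac{2}{\pi|b|^2}\Bigl((|b|^2-|a|^2)\arccos|a|+|a||b|\Bigr).$$ Moreover, if $|a|=\cos\varphi$ with $\varphi\in[0,\frac{\pi}{2}]$, then $$P_\infty^{(1)}(1,0)=\frac{\sin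 2\varphi-2\varphi\cos 2\varphi}{\pi\sin^2\varphi}.$$ -/

import Mathlib

noncomputable section

namespace QuantumWalk

/-- The Hilbert space `ℓ²(G × S)` of states of a walk on `G` with internal states `S`. -/
abbrev State (G : Type*) (S : Finset G) : Type _ :=
  lp (fun _ : G × S => ℂ) 2

section General

variable {G : Type*} {S : Finset G}

theorem memlp_two_iff {ι : Type*} {f : ι → ℂ} :
    Memℓp f 2 ↔ Summable fun i => ‖f i‖ ^ (2 : ℝ) := by
  have h := memℓp_gen_iff (E := fun _ : ι => ℂ) (p := 2) (f := f) (by norm_num)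
  simpa using h

/-- The basis state `|g⟩|σ⟩`, for `x = (g, σ)`. -/
def ket [DecidableEq G] (x : G × S) : State G S :=
  lp.single 2 x (1 : ℂ)

theorem memlp_translate [AddGroup G] (ψ : State G S) :
    Memℓp (fun x : G × S => ψ (-(x.2 : G) + x.1, x.2)) 2 := by
  have hinj : Function.Injective (fun x : G × S => ((-(x.2 : G) + x.1, x.2) : G × S)) := by
    rintro ⟨g, σ⟩ ⟨g', σ'⟩ h
    simp only [Prod.mk.injEq] at h
    obtain ⟨h1, rfl⟩ := h
    simpa using h1
  exact memlp_two_iff.2 ((memlp_two_iff.1 (lp.memℓp ψ)).comp_injective hinj)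

/-- The translation `T : |g⟩|σ⟩ ↦ |σ + g⟩|σ⟩`, written on coordinates. -/
def translation [AddGroup G] : State G S →ₗ[ℂ] State G S where
  toFun ψ := ⟨fun x => ψ (-(x.2 : G) + x.1, x.2), memlp_translate ψ⟩
  map_add' _ _ := rfl
  map_smul' _ _ := rfl

theorem memlp_coin (U : Matrix S S ℂ) (ψ : State G S) :
    Memℓp (fun x : G × S => ∑ τ : S, U x.2 τ * ψ (x.1, τ)) 2 := by
  have hτ : ∀ τ ∈ (Finset.univ : Finset S),
      Memℓp (fun x : G × S => U x.2 τ * ψ (x.1, τ)) 2 := by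
    intro τ _
    rw [memlp_two_iff]
    have hinj : Function.Injective (fun g : G => ((g, τ) : G × S)) := fun g g' h => by
      simpa using h
    have h1 : Summable fun g : G => ‖ψ (g, τ)‖ ^ (2 : ℝ) :=
      (memlp_two_iff.1 (lp.memℓp ψ)).comp_injective hinj
    have h2 : Summable fun σ : S => ‖U σ τ‖ ^ (2 : ℝ) := Summable.of_finite
    refine (h1.mul_of_nonneg h2 (fun _ => by positivity) (fun _ => by positivity)).congr ?_
    intro x
    rw [norm_mul, Real.mul_rpow (norm_nonneg _) (norm_nonneg _), mul_comm]
  have h := Memℓp.finsetSum Finset.univ hτ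
  simpa using h

/-- The operator `I ⊗ U`, i.e. `|g⟩|τ⟩ ↦ ∑ σ, U σ τ |g⟩|σ⟩`, written on coordinates. -/
def coin (U : Matrix S S ℂ) : State G S →ₗ[ℂ] State G S where
  toFun ψ := ⟨fun x => ∑ τ : S, U x.2 τ * ψ (x.1, τ), memlp_coin U ψ⟩
  map_add' ψ χ := by
    ext x
    simp only [lp.coeFn_add, Pi.add_apply, mul_add, Finset.sum_add_distrib]
  map_smul' c ψ := by
    ext x
    simp [Finset.mul_sum, mul_left_comm]

theorem translation_apply [AddGroup G] (ψ : State G S) (x : G × S) :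
    translation ψ x = ψ (-(x.2 : G) + x.1, x.2) := rfl

theorem coin_apply (U : Matrix S S ℂ) (ψ : State G S) (x : G × S) :
    coin U ψ x = ∑ τ : S, U x.2 τ * ψ (x.1, τ) := rfl

/-- The quantum walk operator `Q = T (I ⊗ U)` of the triple `(G, S, U)`. -/
def walk [AddGroup G] [DecidableEq G] (U : Matrix.unitaryGroup S ℂ) :
    State G S →ₗ[ℂ] State G S :=
  translation ∘ₗ coin (U : Matrix S S ℂ)

theorem memlp_indicator (s : Set (G × S)) (ψ : State G S) :
    Memℓp (s.indicator (fun x => ψ x)) 2 := by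
  rw [memlp_two_iff]
  refine Summable.of_nonneg_of_le (fun _ => by positivity) (fun x => ?_)
    (memlp_two_iff.1 (lp.memℓp ψ))
  exact Real.rpow_le_rpow (norm_nonneg _) (norm_indicator_le_norm_self _ _) (by norm_num)

/-- The measurement operator `Π_no^B`: the orthogonal projection that removes the components
of a state at the elements of `B`. -/
def projNo (B : Set (G × S)) : State G S →ₗ[ℂ] State G S where
  toFun ψ := ⟨Bᶜ.indicator (fun x => ψ x), memlp_indicator Bᶜ ψ⟩
  map_add' ψ χ := by
    ext x
    change Bᶜ.indicator (fun x => ψ x + χ x) x =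
      Bᶜ.indicator (fun x => ψ x) x + Bᶜ.indicator (fun x => χ x) x
    by_cases hx : x ∈ B <;> simp [hx]
  map_smul' c ψ := by
    ext x
    by_cases hx : x ∈ B <;> simp [hx]

theorem projNo_apply (B : Set (G × S)) (ψ : State G S) (x : G × S) :
    projNo B ψ x = Bᶜ.indicator (fun x => ψ x) x := rfl

/-- The absorbing quantum walk operator `Π_no^B Q` of the quadruple `(G, S, U, B)`. -/
def absorbingWalk [AddGroup G] [DecidableEq G] (U : Matrix.unitaryGroup S ℂ)
    (B : Set (G × S)) : State G S →ₗ[ℂ] State G S :=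
  projNo B ∘ₗ walk U

/-- The amplitude `⟨b| Q (Π_no^B Q)^(t-1) |ψ⟩` with which the walk reaches `b` at time `t`. -/
def amplitude [AddGroup G] [DecidableEq G] (U : Matrix.unitaryGroup S ℂ)
    (B : Set (G × S)) (ψ : State G S) (b : G × S) (t : ℕ) : ℂ :=
  inner ℂ (ket b) (walk U ((absorbingWalk U B ^ (t - 1)) ψ))

/-- The probability of absorption at `B₀ ⊆ B` exactly at time `t ≥ 1`:
`∑ b ∈ B₀, |⟨b| Q (Π_no^B Q)^(t-1) |ψ⟩|²`. -/
def absorptionAt [AddGroup G] [DecidableEq G] (U : Matrix.unitaryGroup S ℂ)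
    (B B₀ : Set (G × S)) (ψ : State G S) (t : ℕ) : ℝ :=
  ∑' b : B₀, ‖amplitude U B ψ b t‖ ^ 2

/-- The probability of eventual absorption at `B₀` before absorption elsewhere in `B`:
the sum over all times `t = 1, 2, 3, …`. -/
def absorptionProb [AddGroup G] [DecidableEq G] (U : Matrix.unitaryGroup S ℂ)
    (B B₀ : Set (G × S)) (ψ : State G S) : ℝ :=
  ∑' t : ℕ, absorptionAt U B B₀ ψ (t + 1)

end General

/-- The set `C₁ = {1, -1}` of unit steps in `ℤ`. -/
def C₁ : Finset ℤ := {1, -1}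

/-- The internal state that moves to the right. -/
def R : C₁ := ⟨1, by decide⟩

/-- The internal state that moves to the left. -/
def L : C₁ := ⟨-1, by decide⟩

/-- The absorbing boundary at position `0` (in every internal state). -/
def boundary : Set (ℤ × C₁) := {x | x.1 = 0}

/-- The initial state `|m⟩(α|R⟩ + β|L⟩)`. -/
def initial (m : ℤ) (α β : ℂ) : State ℤ C₁ :=
  α • ket (m, R) + β • ket (m, L)

/-- The probability that the `(ℤ, C₁, U, {0})` walk started at `|m⟩(α|R⟩ + β|L⟩)` is absorbed
at `0` exactly at time `t ≥ 1`. -/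
def semiInfiniteAt (U : Matrix.unitaryGroup C₁ ℂ) (m : ℤ) (α β : ℂ) (t : ℕ) : ℝ :=
  absorptionAt U boundary boundary (initial m α β) t

/-- `P_∞^{(m)}(α, β)`: the probability that the `(ℤ, C₁, U, {0})` walk started at
`|m⟩(α|R⟩ + β|L⟩)` is eventually absorbed at `0`. -/
def semiInfiniteProb (U : Matrix.unitaryGroup C₁ ℂ) (m : ℤ) (α β : ℂ) : ℝ :=
  absorptionProb U boundary boundary (initial m α β)

end QuantumWalk

end

/-! To reach 0 from height j + 1 the walk must descend one level at a time, and each first arrival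
at a lower level is in state `L`. So the arrival amplitudes are governed by two power series f, g
(starts `R` and `L` at height 1), and conditioning on the first step gives f = X(c + afg), g = X(d +
bfg), where c, d are the second row of `U`. Eliminating g leaves a quadratic equation for f. With β
= |b|² and Δ = det `U`, its solution is f = cX F(ΔX²), where F = 1 + XF - βXF². Since |Δ| = 1 and
|c|² = β, the absorption probability is Σ β rₙ², with rₙ the coefficients of F.

To sum the squares, put x = 1 - 2β. The square root of the discriminant is D = 1 - X + 2βXF, and D²
= 1 - 2xX + X², the Legendre generating polynomial; hence the rₙ satisfy a three-term recurrence.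
The cosine integrals of √(cos θ - x), truncated to 0 where cos θ < x, at frequencies n + 1/2 satisfy
the same recurrence (`sqrtCosTransform_recurrence`), so `sqrtCosTransform_eq` identifies them with
the rₙ up to a constant factor. Parseval then reduces the sum to the elementary integral of (cos θ -
x)₊. -/

/-! ### Cosine coefficients of the truncated square root, and Parseval -/

/-- The cosine transform of the function `θ ↦ √(cos θ - x)`, which vanishes where `cos θ ≤ x`. -/
noncomputable def sqrtCosTransform (x k : ℝ) : ℝ :=
  ∫ θ in (-Real.pi)..Real.pi, √(Real.cos θ - x) * Real.cos (k * θ)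

/-- The truncated power y^(3/2) is differentiable even at 0, so the integration by parts below needs
no splitting at the points where cos θ = x. -/
theorem hasDerivAt_sqrt_cube (y : ℝ) : HasDerivAt (fun y : ℝ => √y ^ 3) (3 / 2 * √y) y := by
  have h : (fun y : ℝ => √y ^ 3) = fun y => √y * max y 0 := by
    funext y
    rw [pow_succ', ← Real.sq_sqrt']
  rcases lt_trichotomy y 0 with hy | rfl | hy
  · rw [Real.sqrt_eq_zero_of_nonpos hy.le, mul_zero]
    refine (hasDerivAt_const y (0 : ℝ)).congr_of_eventuallyEq ?_
    filter_upwards [gt_mem_nhds hy] with z hz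
    simp [Real.sqrt_eq_zero_of_nonpos hz.le]
  · rw [Real.sqrt_zero, mul_zero, h, hasDerivAt_iff_isLittleO_nhds_zero]
    simp only [zero_add, Real.sqrt_zero, zero_mul, sub_zero, smul_zero]
    have h1 : (fun z : ℝ => √z) =o[nhds 0] fun _ => (1 : ℝ) := by
      rw [Asymptotics.isLittleO_one_iff]
      simpa using Real.continuous_sqrt.tendsto 0
    have h2 : (fun z : ℝ => max z 0) =O[nhds 0] fun z => z :=
      Asymptotics.IsBigO.of_bound 1 (Filter.Eventually.of_forall fun z => by
        rw [one_mul, Real.norm_eq_abs, Real.norm_eq_abs]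
        rcases le_total z 0 with hz | hz <;> simp [hz])
    simpa using h1.mul_isBigO h2
  · have h1 := (Real.hasDerivAt_sqrt hy.ne').pow 3
    refine h1.congr_deriv ?_
    have h3 := Real.sqrt_pos.2 hy
    field_simp
    norm_num [mul_comm]

/-- Integrate the derivative of (cos θ - x)₊^(3/2) sin kθ over [-π, π]. The boundary terms vanish
because -1 - x ≤ 0, and the product formulas turn the integrand into frequencies k - 1, k, k + 1. -/
theorem sqrtCosTransform_recurrence {x : ℝ} (hx : -1 ≤ x) (k : ℝ) :
    (k / 2 - 3 / 4) * sqrtCosTransform x (k - 1) + (k / 2 + 3 / 4) * sqrtCosTransform x (k + 1) =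
      k * x * sqrtCosTransform x k := by
  have hd : ∀ θ : ℝ, HasDerivAt (fun θ => √(Real.cos θ - x) ^ 3 * Real.sin (k * θ))
      (3 / 2 * √(Real.cos θ - x) * (-Real.sin θ) * Real.sin (k * θ) +
        √(Real.cos θ - x) ^ 3 * (Real.cos (k * θ) * k)) θ := fun θ => by
    have h1 : HasDerivAt (fun θ => Real.cos θ - x) (-Real.sin θ) θ :=
      (Real.hasDerivAt_cos θ).sub_const x
    have h2 : HasDerivAt (fun θ => k * θ) k θ := by simpa using (hasDerivAt_id θ).const_mul k
    exact ((hasDerivAt_sqrt_cube _).comp θ h1).mul h2.sin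
  have hI : ∀ j : ℝ, IntervalIntegrable (fun θ => √(Real.cos θ - x) * Real.cos (j * θ))
      MeasureTheory.volume (-Real.pi) Real.pi := fun j =>
    Continuous.intervalIntegrable (by fun_prop) _ _
  have h := intervalIntegral.integral_eq_sub_of_hasDerivAt
    (a := -Real.pi) (b := Real.pi) (fun θ _ => hd θ)
    (Continuous.intervalIntegrable (by fun_prop) _ _)
  have h0 : √(-1 - x) = 0 := Real.sqrt_eq_zero_of_nonpos (by linarith)
  simp only [Real.cos_neg, Real.cos_pi, h0] at h
  norm_num at h
  unfold sqrtCosTransform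
  rw [← sub_eq_zero, ← h, ← intervalIntegral.integral_const_mul,
    ← intervalIntegral.integral_const_mul, ← intervalIntegral.integral_const_mul,
    ← intervalIntegral.integral_add ((hI _).const_mul _) ((hI _).const_mul _),
    ← intervalIntegral.integral_sub (((hI _).const_mul _).add ((hI _).const_mul _))
      ((hI _).const_mul _)]
  refine intervalIntegral.integral_congr fun θ _ => ?_
  have h3 : √(Real.cos θ - x) ^ 3 = √(Real.cos θ - x) * (Real.cos θ - x) := by
    rcases le_total (Real.cos θ - x) 0 with hc | hc
    · simp [Real.sqrt_eq_zero_of_nonpos hc]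
    · rw [pow_succ', Real.sq_sqrt hc]
  simp only [h3, sub_mul, add_mul, one_mul, Real.cos_sub, Real.cos_add]
  ring

theorem integral_sqrt_sub_sq {β : ℝ} (h0 : 0 < β) (h1 : β ≤ 1) :
    ∫ s in (-1 : ℝ)..1, √(β - s ^ 2) = β * Real.pi / 2 := by
  have hs : 0 < √β := Real.sqrt_pos.2 h0
  have hs1 : √β ≤ 1 := Real.sqrt_le_one.2 h1
  have hsq : √β ^ 2 = β := Real.sq_sqrt h0.le
  have hint : ∀ a b : ℝ, IntervalIntegrable (fun s => √(β - s ^ 2)) MeasureTheory.volume a b :=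
    fun a b => Continuous.intervalIntegrable (by fun_prop) _ _
  have e1 : ∫ s in (-1 : ℝ)..(-√β), √(β - s ^ 2) = 0 := by
    rw [intervalIntegral.integral_congr (g := fun _ => (0 : ℝ)) fun s hs' => ?_]
    · simp
    rw [Set.uIcc_of_le (by linarith)] at hs'
    exact Real.sqrt_eq_zero_of_nonpos (by nlinarith [hs'.1, hs'.2])
  have e2 : ∫ s in √β..(1 : ℝ), √(β - s ^ 2) = 0 := by
    rw [intervalIntegral.integral_congr (g := fun _ => (0 : ℝ)) fun s hs' => ?_]
    · simp
    rw [Set.uIcc_of_le (by linarith)] at hs'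
    exact Real.sqrt_eq_zero_of_nonpos (by nlinarith [hs'.1, hs'.2])
  have e3 : ∫ s in (-√β)..√β, √(β - s ^ 2) = β * Real.pi / 2 := by
    have h := intervalIntegral.smul_integral_comp_mul_left (a := -1) (b := 1)
      (fun s => √(β - s ^ 2)) √β
    rw [mul_neg, mul_one] at h
    rw [← h, ← intervalIntegral.integral_congr (f := fun y => √β * √(1 - y ^ 2)) fun y _ => ?_]
    · rw [intervalIntegral.integral_const_mul, integral_sqrt_one_sub_sq, smul_eq_mul, ← mul_assoc,
        Real.mul_self_sqrt h0.le, mul_div_assoc]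
    · change √β * √(1 - y ^ 2) = √(β - (√β * y) ^ 2)
      rw [← Real.sqrt_mul h0.le, mul_pow, hsq, mul_sub, mul_one]
  rw [← intervalIntegral.integral_add_adjacent_intervals (hint (-1) (-√β)) (hint _ _),
    ← intervalIntegral.integral_add_adjacent_intervals (hint (-√β) √β) (hint _ _), e1, e2, e3]
  ring

/-- The substitution s = sin(θ/2) gives cos θ - x = 2(β - s²), so the integral is a multiple of the
area of a half disc of radius √β. -/
theorem sqrtCosTransform_one_half {β : ℝ} (h0 : 0 < β) (h1 : β ≤ 1) :
    sqrtCosTransform (1 - 2 * β) (1 / 2) = √2 * Real.pi * β := by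
  have hd : ∀ θ : ℝ, HasDerivAt (fun θ => Real.sin (1 / 2 * θ)) (Real.cos (1 / 2 * θ) * (1 / 2)) θ :=
    fun θ => by
      have h2 : HasDerivAt (fun θ : ℝ => 1 / 2 * θ) (1 / 2) θ := by
        simpa using (hasDerivAt_id θ).const_mul (1 / 2 : ℝ)
      exact h2.sin
  have h := intervalIntegral.integral_comp_mul_deriv (a := -Real.pi) (b := Real.pi)
    (g := fun s => √(β - s ^ 2)) (fun θ _ => hd θ) (by fun_prop) (by fun_prop)
  have e : (1 / 2 : ℝ) * Real.pi = Real.pi / 2 := by ring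
  simp only [mul_neg, Real.sin_neg, e, Real.sin_pi_div_two] at h
  rw [integral_sqrt_sub_sq h0 h1] at h
  rw [show √2 * Real.pi * β = 2 * √2 * (β * Real.pi / 2) by ring, ← h,
    ← intervalIntegral.integral_const_mul]
  refine intervalIntegral.integral_congr fun θ _ => ?_
  have hc : Real.cos θ - (1 - 2 * β) = 2 * (β - Real.sin (1 / 2 * θ) ^ 2) := by
    have := Real.cos_two_mul (1 / 2 * θ)
    have h4 := Real.sin_sq_add_cos_sq (1 / 2 * θ)
    rw [show 2 * (1 / 2 * θ) = θ by ring] at this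
    linarith
  simp only [Function.comp, hc, Real.sqrt_mul zero_le_two]
  ring

theorem integral_sqrt_cos_sub_sq {x : ℝ} (h0 : -1 ≤ x) (h1 : x ≤ 1) :
    ∫ θ in (-Real.pi)..Real.pi, √(Real.cos θ - x) ^ 2 =
      2 * (√(1 - x ^ 2) - x * Real.arccos x) := by
  set α := Real.arccos x with hα
  have hα0 : 0 ≤ α := Real.arccos_nonneg x
  have hαπ : α ≤ Real.pi := Real.arccos_le_pi x
  have hcos : Real.cos α = x := Real.cos_arccos h0 h1
  have hint : ∀ a b : ℝ,
      IntervalIntegrable (fun θ => √(Real.cos θ - x) ^ 2) MeasureTheory.volume a b :=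
    fun a b => Continuous.intervalIntegrable (by fun_prop) _ _
  have e2 : ∫ θ in α..Real.pi, √(Real.cos θ - x) ^ 2 = 0 := by
    rw [intervalIntegral.integral_congr (g := fun _ => (0 : ℝ)) fun s hs' => ?_]
    · simp
    rw [Set.uIcc_of_le hαπ] at hs'
    have := Real.cos_le_cos_of_nonneg_of_le_pi hα0 hs'.2 hs'.1
    simp [Real.sqrt_eq_zero_of_nonpos (show Real.cos s - x ≤ 0 by linarith)]
  have e3 : ∫ θ in (0 : ℝ)..α, √(Real.cos θ - x) ^ 2 = √(1 - x ^ 2) - x * α := by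
    rw [intervalIntegral.integral_congr (g := fun θ => Real.cos θ - x) fun s hs' => ?_]
    · rw [intervalIntegral.integral_sub (by simp) (by simp)]
      simp [hα, Real.sin_arccos, mul_comm]
    rw [Set.uIcc_of_le hα0] at hs'
    have := Real.cos_le_cos_of_nonneg_of_le_pi hs'.1 hαπ hs'.2
    exact Real.sq_sqrt (by linarith)
  have e4 : ∫ θ in (0 : ℝ)..Real.pi, √(Real.cos θ - x) ^ 2 = √(1 - x ^ 2) - x * α := by
    rw [← intervalIntegral.integral_add_adjacent_intervals (hint 0 α) (hint _ _), e2, e3, add_zero]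
  have e5 : ∫ θ in (-Real.pi)..0, √(Real.cos θ - x) ^ 2 = √(1 - x ^ 2) - x * α := by
    have h := intervalIntegral.integral_comp_neg (a := 0) (b := Real.pi)
      (fun θ => √(Real.cos θ - x) ^ 2)
    simp only [Real.cos_neg, neg_zero] at h
    rw [← h, e4]
  rw [← intervalIntegral.integral_add_adjacent_intervals (hint _ 0) (hint _ _), e4, e5]
  ring

theorem integral_eq_zero_of_odd {f : ℝ → ℝ} (hf : ∀ θ, f (-θ) = -f θ) (a : ℝ) :
    ∫ θ in (-a)..a, f θ = 0 := by
  have h := intervalIntegral.integral_comp_neg (a := -a) (b := a) f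
  simp only [hf, intervalIntegral.integral_neg, neg_neg] at h
  linarith

/-- The factor exp(-iθ/2) shifts integer frequencies to half-integer ones; the sine part is odd and
integrates to zero. -/
theorem fourierCoeffOn_sqrt_cos (x : ℝ) (n : ℤ) :
    fourierCoeffOn (neg_lt_self Real.pi_pos)
      (fun θ : ℝ => (√(Real.cos θ - x) : ℂ) * Complex.exp (-(θ / 2 : ℝ) * Complex.I)) n =
      ((1 / (2 * Real.pi) * sqrtCosTransform x (n + 1 / 2) : ℝ) : ℂ) := by
  rw [fourierCoeffOn_eq_integral, Complex.ofReal_mul, ← Complex.real_smul, sub_neg_eq_add,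
    ← two_mul]
  congr 1
  have hpt : ∀ θ : ℝ, fourier (-n) (θ : AddCircle (2 * Real.pi)) •
      ((√(Real.cos θ - x) : ℂ) * Complex.exp (-(θ / 2 : ℝ) * Complex.I)) =
      ((√(Real.cos θ - x) * Real.cos ((n + 1 / 2) * θ) : ℝ) : ℂ) -
      ((√(Real.cos θ - x) * Real.sin ((n + 1 / 2) * θ) : ℝ) : ℂ) * Complex.I := fun θ => by
    rw [fourier_coe_apply, smul_eq_mul, mul_left_comm, ← Complex.exp_add,
      show 2 * (Real.pi : ℂ) * Complex.I * ((-n : ℤ) : ℂ) * θ / ((2 * Real.pi : ℝ) : ℂ) +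
        -(θ / 2 : ℝ) * Complex.I = ((-((n + 1 / 2) * θ) : ℝ) : ℂ) * Complex.I by
          have : (Real.pi : ℂ) ≠ 0 := by exact_mod_cast Real.pi_ne_zero
          push_cast
          field_simp
          ring,
      Complex.exp_mul_I, ← Complex.ofReal_cos, ← Complex.ofReal_sin, Real.cos_neg, Real.sin_neg]
    push_cast
    ring
  simp only [hpt]
  rw [intervalIntegral.integral_sub (Continuous.intervalIntegrable (by fun_prop) _ _)
    (Continuous.intervalIntegrable (by fun_prop) _ _), intervalIntegral.integral_mul_const,
    intervalIntegral.integral_ofReal, intervalIntegral.integral_ofReal,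
    integral_eq_zero_of_odd (f := fun θ => √(Real.cos θ - x) * Real.sin ((n + 1 / 2) * θ))
      fun θ => by rw [Real.cos_neg, mul_neg, Real.sin_neg, mul_neg]]
  simp [sqrtCosTransform]

theorem sqrtCosTransform_neg (x k : ℝ) : sqrtCosTransform x (-k) = sqrtCosTransform x k := by
  simp [sqrtCosTransform]

theorem hasSum_sq_sqrtCosTransform {x : ℝ} (h0 : -1 ≤ x) (h1 : x ≤ 1) :
    HasSum (fun n : ℕ => sqrtCosTransform x (n + 1 / 2) ^ 2)
      (2 * Real.pi * (√(1 - x ^ 2) - x * Real.arccos x)) := by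
  have hcont : Continuous
      (fun θ : ℝ => (√(Real.cos θ - x) : ℂ) * Complex.exp (-(θ / 2 : ℝ) * Complex.I)) := by
    fun_prop
  have hn : ∀ θ : ℝ,
      ‖(√(Real.cos θ - x) : ℂ) * Complex.exp (-(θ / 2 : ℝ) * Complex.I)‖ = √(Real.cos θ - x) :=
    fun θ => by
      rw [norm_mul, ← Complex.ofReal_neg, Complex.norm_exp_ofReal_mul_I, mul_one,
        Complex.norm_of_nonneg (Real.sqrt_nonneg _)]
  have hL2 : MeasureTheory.MemLp
      (fun θ : ℝ => (√(Real.cos θ - x) : ℂ) * Complex.exp (-(θ / 2 : ℝ) * Complex.I)) 2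
      (MeasureTheory.volume.restrict (Set.Ioc (-Real.pi) Real.pi)) :=
    .of_bound hcont.aestronglyMeasurable (√(1 - x)) (Filter.Eventually.of_forall fun θ => by
      rw [hn]
      exact Real.sqrt_le_sqrt (by linarith [Real.cos_le_one θ]))
  have h := hasSum_sq_fourierCoeffOn (neg_lt_self Real.pi_pos) hL2
  simp only [fourierCoeffOn_sqrt_cos, Complex.norm_real, hn, Real.norm_eq_abs, sq_abs,
    integral_sqrt_cos_sub_sq h0 h1] at h
  -- The indices n and -(n + 1) correspond to the frequencies ±(n + 1/2), so the Parseval sum over ℤ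
  -- is twice a sum over ℕ.
  have hc : ∀ n : ℕ, sqrtCosTransform x ((-(n + 1 : ℕ) : ℤ) + 1 / 2) =
      sqrtCosTransform x (n + 1 / 2) := fun n => by
    rw [← sqrtCosTransform_neg]
    congr 1
    push_cast
    ring
  have h2 := (h.nat_add_neg_add_one).mul_left (2 * Real.pi ^ 2)
  have hπ := Real.pi_pos
  have e1 : 2 * Real.pi ^ 2 * (Real.pi - -Real.pi)⁻¹ • (2 * (√(1 - x ^ 2) - x * Real.arccos x)) =
      2 * Real.pi * (√(1 - x ^ 2) - x * Real.arccos x) := by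
    rw [smul_eq_mul, sub_neg_eq_add, ← two_mul]
    field_simp
  rw [e1] at h2
  refine h2.congr_fun fun n => ?_
  have := hc n
  push_cast at this ⊢
  rw [this]
  field_simp
  ring

/-! ### The quadratic power series and its link with the cosine coefficients -/

/-- The coefficients of the power series solution of `F = 1 + X F - β X F ^ 2`. -/
noncomputable def returnCoeff (β : ℝ) : ℕ → ℝ
  | 0 => 1
  | n + 1 => returnCoeff β n -
      β * ∑ i : Fin (n + 1), returnCoeff β i * returnCoeff β (n - i)
termination_by n => n
decreasing_by all_goals omega

/-- The power series solution of `F = 1 + X F - β X F ^ 2`. -/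
noncomputable def returnSeries (β : ℝ) : PowerSeries ℝ :=
  PowerSeries.mk (returnCoeff β)

theorem returnSeries_eq (β : ℝ) :
    returnSeries β = 1 + PowerSeries.X * returnSeries β -
      PowerSeries.C β * (PowerSeries.X * returnSeries β ^ 2) := by
  ext n
  cases n with
  | zero => simp [returnSeries, returnCoeff]
  | succ n =>
    rw [map_sub, map_add, PowerSeries.coeff_C_mul, PowerSeries.coeff_succ_X_mul,
      PowerSeries.coeff_succ_X_mul, pow_two, PowerSeries.coeff_mul, returnSeries,
      Finset.Nat.sum_antidiagonal_eq_sum_range_succ_mk, Finset.sum_range]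
    simp [returnCoeff, PowerSeries.coeff_one]

theorem returnCoeff_recurrence {β : ℝ} (hβ : β ≠ 0) (n : ℕ) :
    (n + 3) * returnCoeff β (n + 2) =
      (2 * n + 3) * (1 - 2 * β) * returnCoeff β (n + 1) - n * returnCoeff β n := by
  set F := returnSeries β with hF
  set x : ℝ := 1 - 2 * β with hx
  set D : PowerSeries ℝ := 1 - PowerSeries.X + PowerSeries.C (2 * β) * (PowerSeries.X * F) with hD
  have hDD : D * D = 1 - PowerSeries.C (2 * x) * PowerSeries.X + PowerSeries.X ^ 2 := by
    have h := returnSeries_eq β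
    rw [← hF] at h
    rw [hD, hx]
    simp only [map_mul, map_sub, map_one, map_ofNat]
    linear_combination (4 * PowerSeries.C β * PowerSeries.X) * h
  have hd : D * PowerSeries.derivative ℝ D = PowerSeries.X - PowerSeries.C x := by
    have h := congrArg (PowerSeries.derivative ℝ) hDD
    simp only [Derivation.leibniz, PowerSeries.derivative_one, map_add, map_sub, smul_eq_mul,
      PowerSeries.derivative_X, PowerSeries.derivative_C, pow_two] at h
    have hx2 : PowerSeries.C (2 * x) = 2 * PowerSeries.C x := by rw [map_mul, map_ofNat]
    have hhalf : PowerSeries.C (1 / 2 : ℝ) * 2 = 1 := by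
      rw [← map_ofNat (PowerSeries.C (R := ℝ)) 2, ← map_mul]
      norm_num
    linear_combination PowerSeries.C (1 / 2 : ℝ) * h - PowerSeries.C (1 / 2 : ℝ) * hx2 -
      (D * PowerSeries.derivative ℝ D - PowerSeries.X + PowerSeries.C x) * hhalf
  -- Multiplying D D' = X - x by D gives the linear equation (1 - 2xX + X²) D' = (X - x) D.
  have hode : PowerSeries.derivative ℝ D - PowerSeries.C (2 * x) * (PowerSeries.X *
      PowerSeries.derivative ℝ D) + PowerSeries.X * (PowerSeries.X * PowerSeries.derivative ℝ D) =
      PowerSeries.X * D - PowerSeries.C x * D := by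
    rw [map_mul, map_ofNat] at hDD ⊢
    linear_combination D * hd - PowerSeries.derivative ℝ D * hDD
  have hcoeff : ∀ m, PowerSeries.coeff (m + 2) D = 2 * β * returnCoeff β (m + 1) := fun m => by
    rw [hD, map_add, map_sub, PowerSeries.coeff_C_mul, PowerSeries.coeff_succ_X_mul, hF,
      returnSeries, PowerSeries.coeff_mk, PowerSeries.coeff_one, PowerSeries.coeff_X]
    simp
  -- For n = 0 the coefficient of X in D has an extra -1 coming from 1 - X, but the factor n kills
  -- it.
  have hn : (n : ℝ) * PowerSeries.coeff (n + 1) D = n * (2 * β * returnCoeff β n) := by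
    cases n with
    | zero => simp
    | succ n => rw [hcoeff]
  have h := congrArg (PowerSeries.coeff (n + 2)) hode
  simp only [map_sub, map_add, PowerSeries.coeff_C_mul, PowerSeries.coeff_succ_X_mul,
    PowerSeries.coeff_derivative, hcoeff] at h
  push_cast at h
  refine mul_left_cancel₀ (mul_ne_zero two_ne_zero hβ) ?_
  linear_combination h - hn

theorem sqrtCosTransform_eq {β : ℝ} (h0 : 0 < β) (h1 : β ≤ 1) (n : ℕ) :
    sqrtCosTransform (1 - 2 * β) (n + 1 / 2) = √2 * Real.pi * β * returnCoeff β n := by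
  have hzero : sqrtCosTransform (1 - 2 * β) (1 / 2) = √2 * Real.pi * β * returnCoeff β 0 := by
    rw [sqrtCosTransform_one_half h0 h1, returnCoeff, mul_one]
  induction n using Nat.twoStepInduction with
  | zero => rw [Nat.cast_zero, zero_add, hzero]
  | one =>
    -- At k = 1/2 the frequencies k - 1 and k are opposite, so evenness determines the second value
    -- from the first.
    have h := sqrtCosTransform_recurrence (x := 1 - 2 * β) (by linarith) (1 / 2)
    rw [show (1 / 2 - 1 : ℝ) = -(1 / 2) by norm_num, sqrtCosTransform_neg, hzero] at h
    have hp : returnCoeff β 1 = 1 - β := by simp [returnCoeff]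
    rw [hp, Nat.cast_one, add_comm (1 : ℝ)]
    rw [show returnCoeff β 0 = 1 by rw [returnCoeff]] at h
    linear_combination h
  | more n ih0 ih1 =>
    have h := sqrtCosTransform_recurrence (x := 1 - 2 * β) (by linarith) (n + 3 / 2)
    rw [show (n + 3 / 2 - 1 : ℝ) = n + 1 / 2 by ring,
      show (n + 3 / 2 + 1 : ℝ) = (n + 2 : ℕ) + 1 / 2 by push_cast; ring,
      show (n + 3 / 2 : ℝ) = (n + 1 : ℕ) + 1 / 2 by push_cast; ring, ih0, ih1] at h
    push_cast at h ⊢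
    have hr := returnCoeff_recurrence h0.ne' n
    refine mul_left_cancel₀ (show (n + 3 : ℝ) ≠ 0 by positivity) ?_
    linear_combination 2 * h - √2 * Real.pi * β * hr

theorem hasSum_sq_returnCoeff {β : ℝ} (h0 : 0 < β) (h1 : β ≤ 1) :
    HasSum (fun n : ℕ => β * returnCoeff β n ^ 2)
      ((√(1 - (1 - 2 * β) ^ 2) - (1 - 2 * β) * Real.arccos (1 - 2 * β)) / (Real.pi * β)) := by
  have h := (hasSum_sq_sqrtCosTransform (x := 1 - 2 * β) (by linarith) (by linarith)).div_const
    (2 * Real.pi ^ 2 * β)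
  have hπ := Real.pi_pos
  have e : 2 * Real.pi * (√(1 - (1 - 2 * β) ^ 2) - (1 - 2 * β) * Real.arccos (1 - 2 * β)) /
      (2 * Real.pi ^ 2 * β) =
      (√(1 - (1 - 2 * β) ^ 2) - (1 - 2 * β) * Real.arccos (1 - 2 * β)) / (Real.pi * β) := by
    field_simp
  rw [e] at h
  refine h.congr_fun fun n => ?_
  rw [sqrtCosTransform_eq h0 h1, mul_pow, mul_pow, mul_pow, Real.sq_sqrt zero_le_two]
  field_simp

/-! ### Arrival series of the walk -/

namespace QuantumWalk

/-- Solving the second equation as g = Xd / E with E = 1 - bXf turns the first into f E = cX + ΔX²f.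
The choice f = cX G with G = F(ΔX²) solves this because bc = -Δβ. -/
theorem exists_arrival_series {a b c d : ℂ} {β : ℝ} {Δ : ℂ} (hΔ : a * d - b * c = Δ)
    (hbc : b * c = -(Δ * β)) :
    ∃ f g : PowerSeries ℂ,
      f = PowerSeries.X * (PowerSeries.C c + PowerSeries.C a * f * g) ∧
      g = PowerSeries.X * (PowerSeries.C d + PowerSeries.C b * f * g) ∧
      (∀ n, PowerSeries.coeff (2 * n) f = 0) ∧
      ∀ n, PowerSeries.coeff (2 * n + 1) f = c * Δ ^ n * returnCoeff β n := by
  set G : PowerSeries ℂ := PowerSeries.expand 2 two_ne_zero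
    (PowerSeries.rescale Δ (PowerSeries.map Complex.ofRealHom (returnSeries β))) with hG
  have hC : ∀ z : ℂ, PowerSeries.rescale Δ (PowerSeries.C z) = PowerSeries.C z := fun z => by
    ext n
    rw [PowerSeries.coeff_rescale, PowerSeries.coeff_C]
    split_ifs with hn <;> simp [hn]
  have hGeq : G = 1 + PowerSeries.C Δ * PowerSeries.X ^ 2 * G -
      PowerSeries.C (β : ℂ) * (PowerSeries.C Δ * PowerSeries.X ^ 2 * G ^ 2) := by
    have h := congrArg (fun F => PowerSeries.expand 2 two_ne_zero
      (PowerSeries.rescale Δ (PowerSeries.map Complex.ofRealHom F))) (returnSeries_eq β)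
    simp only [map_sub, map_add, map_mul, map_one, map_pow, PowerSeries.map_X,
      PowerSeries.rescale_X, PowerSeries.map_C, hC, PowerSeries.expand_C,
      PowerSeries.expand_X, Complex.ofRealHom_eq_coe] at h
    exact h
  have hGc : ∀ n, PowerSeries.coeff (2 * n) G = Δ ^ n * returnCoeff β n := fun n => by
    rw [hG, PowerSeries.coeff_expand_mul, PowerSeries.coeff_rescale, PowerSeries.coeff_map,
      returnSeries, PowerSeries.coeff_mk, Complex.ofRealHom_eq_coe]
  have hGo : ∀ n, PowerSeries.coeff (2 * n + 1) G = 0 := fun n =>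
    PowerSeries.coeff_expand_of_not_dvd _ _ _ (by omega)
  set f : PowerSeries ℂ := PowerSeries.X * (PowerSeries.C c * G) with hf
  set E : PowerSeries ℂ := 1 - PowerSeries.C b * PowerSeries.X * f with hE
  have hEinv : E * E⁻¹ = 1 := PowerSeries.mul_inv_cancel _ (by simp [hE])
  have hE0 : E ≠ 0 := left_ne_zero_of_mul_eq_one hEinv
  have hΔ' := congrArg (PowerSeries.C (R := ℂ)) hΔ
  have hbc' := congrArg (PowerSeries.C (R := ℂ)) hbc
  simp only [map_mul, map_neg, map_sub] at hΔ' hbc'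
  have hquad : f * E = PowerSeries.X * PowerSeries.C c + PowerSeries.X ^ 2 * PowerSeries.C Δ * f := by
    rw [hE, hf]
    linear_combination (PowerSeries.X * PowerSeries.C c) * hGeq -
      (PowerSeries.X ^ 3 * PowerSeries.C c * G ^ 2) * hbc'
  refine ⟨f, PowerSeries.X * PowerSeries.C d * E⁻¹, ?_, ?_, fun n => ?_, fun n => ?_⟩
  · refine mul_right_cancel₀ hE0 ?_
    linear_combination hquad - (PowerSeries.X ^ 2 * PowerSeries.C a * PowerSeries.C d * f) * hEinv
      - PowerSeries.X * PowerSeries.C c * hE - PowerSeries.X ^ 2 * f * hΔ'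
  · linear_combination (PowerSeries.X * PowerSeries.C d) * hEinv -
      (PowerSeries.X * PowerSeries.C d * E⁻¹) * hE
  · cases n with
    | zero => simp [hf]
    | succ n =>
      rw [hf, show 2 * (n + 1) = 2 * n + 1 + 1 by ring, PowerSeries.coeff_succ_X_mul,
        PowerSeries.coeff_C_mul, hGo, mul_zero]
  · rw [hf, PowerSeries.coeff_succ_X_mul, PowerSeries.coeff_C_mul, hGc, mul_assoc]

theorem eq_R_or_eq_L (σ : C₁) : σ = R ∨ σ = L := by
  revert σ
  decide

theorem sum_C₁ {M : Type*} [AddCommMonoid M] (f : C₁ → M) : ∑ σ : C₁, f σ = f R + f L := by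
  rw [show (Finset.univ : Finset C₁) = {R, L} by decide, Finset.sum_pair (by decide)]

theorem ket_apply (x y : ℤ × C₁) : ket x y = if y = x then 1 else 0 := by
  rw [ket, lp.single_apply, Pi.single_apply]

theorem walk_ket (U : Matrix.unitaryGroup C₁ ℂ) (m : ℤ) (τ : C₁) :
    walk U (ket (m, τ)) = (U : Matrix C₁ C₁ ℂ) R τ • ket (m + 1, R) +
      (U : Matrix C₁ C₁ ℂ) L τ • ket (m - 1, L) := by
  have hRL : R ≠ L := by decide
  ext ⟨g, σ⟩
  change ∑ τ' : C₁, (U : Matrix C₁ C₁ ℂ) σ τ' * ket (m, τ) (-(σ : ℤ) + g, τ') =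
    (U : Matrix C₁ C₁ ℂ) R τ * ket (m + 1, R) (g, σ) +
      (U : Matrix C₁ C₁ ℂ) L τ * ket (m - 1, L) (g, σ)
  have hR : (R : ℤ) = 1 := rfl
  have hL : (L : ℤ) = -1 := rfl
  have e1 : -1 + g = m ↔ g = m + 1 := by omega
  have e2 : 1 + g = m ↔ g = m - 1 := by omega
  simp only [ket_apply, Prod.mk.injEq]
  rcases eq_R_or_eq_L σ with rfl | rfl
  · simp [hR, e1, hRL, ite_and]
  · simp [hL, e2, hRL.symm, ite_and]

theorem projNo_ket (B : Set (ℤ × C₁)) [DecidablePred (· ∈ B)] (x : ℤ × C₁) :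
    projNo B (ket x) = if x ∈ B then 0 else ket x := by
  ext y
  rw [projNo_apply]
  by_cases hx : x ∈ B
  · rw [if_pos hx, lp.coeFn_zero, Pi.zero_apply, Set.indicator_apply_eq_zero]
    intro hy
    rw [ket_apply, if_neg]
    rintro rfl
    exact hy hx
  · rw [if_neg hx, Set.indicator_apply_eq_self]
    intro hy
    rw [ket_apply, if_neg]
    rintro rfl
    exact hy hx

theorem absorbingWalk_ket (U : Matrix.unitaryGroup C₁ ℂ) (j : ℕ) (τ : C₁) :
    absorbingWalk U boundary (ket ((j : ℤ) + 1, τ)) =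
      (U : Matrix C₁ C₁ ℂ) R τ • ket (((j + 1 : ℕ) : ℤ) + 1, R) +
      (U : Matrix C₁ C₁ ℂ) L τ • if j = 0 then 0 else ket ((j : ℤ), L) := by
  classical
  have h1 : (((j : ℤ) + 1 + 1, R) : ℤ × C₁) ∉ boundary := by
    simp only [boundary, Set.mem_ofPred_eq]; omega
  have h2 : (((j : ℤ) + 1 - 1, L) : ℤ × C₁) ∈ boundary ↔ j = 0 := by
    simp [boundary]
  rw [absorbingWalk, LinearMap.comp_apply, walk_ket, map_add, map_smul, map_smul, projNo_ket,
    projNo_ket, if_neg h1]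
  simp only [h2]
  rw [add_sub_cancel_right]
  push_cast
  rfl

section Amplitude

variable {G : Type*} {S : Finset G} [AddGroup G] [DecidableEq G] (U : Matrix.unitaryGroup S ℂ)
  (B : Set (G × S))

theorem amplitude_one (ψ : State G S) (b : G × S) : amplitude U B ψ b 1 = walk U ψ b := by
  simp [amplitude, ket, lp.inner_single_left]

theorem amplitude_succ (ψ : State G S) (b : G × S) (t : ℕ) :
    amplitude U B ψ b (t + 2) = amplitude U B (absorbingWalk U B ψ) b (t + 1) := by
  simp [amplitude, pow_succ]

theorem amplitude_add (ψ χ : State G S) (b : G × S) (t : ℕ) :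
    amplitude U B (ψ + χ) b t = amplitude U B ψ b t + amplitude U B χ b t := by
  simp [amplitude]

theorem amplitude_smul (z : ℂ) (ψ : State G S) (b : G × S) (t : ℕ) :
    amplitude U B (z • ψ) b t = z * amplitude U B ψ b t := by
  simp [amplitude]

theorem amplitude_zero (b : G × S) (t : ℕ) : amplitude U B 0 b t = 0 := by
  simp [amplitude]

end Amplitude

/-- Entering 0 in state `R` requires coming from -1, but the unabsorbed walk stays at positive
positions. -/
theorem amplitude_ket_zero_R (U : Matrix.unitaryGroup C₁ ℂ) (t j : ℕ) (τ : C₁) :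
    amplitude U boundary (ket ((j : ℤ) + 1, τ)) (0, R) (t + 1) = 0 := by
  induction t generalizing j τ with
  | zero =>
    have h1 : (0 : ℤ) ≠ j + 1 + 1 := by omega
    have h2 : R ≠ L := by decide
    rw [amplitude_one, walk_ket, lp.coeFn_add, Pi.add_apply, lp.coeFn_smul, lp.coeFn_smul,
      Pi.smul_apply, Pi.smul_apply, ket_apply, ket_apply]
    simp [h1, h2]
  | succ t ih =>
    rw [amplitude_succ, absorbingWalk_ket, amplitude_add, amplitude_smul, amplitude_smul, ih]
    cases j with
    | zero => rw [if_pos rfl, amplitude_zero, mul_zero, mul_zero, add_zero]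
    | succ j => rw [if_neg j.succ_ne_zero, Nat.cast_succ, ih, mul_zero, mul_zero, add_zero]

/-- The descent from height j + 1 factors into j + 1 successive first passages. The first starts in
state τ; each of the other j starts in `L` and contributes a factor g. -/
theorem amplitude_ket_zero_L (U : Matrix.unitaryGroup C₁ ℂ) {f g : PowerSeries ℂ}
    (hf : f = PowerSeries.X * (PowerSeries.C ((U : Matrix C₁ C₁ ℂ) L R) +
      PowerSeries.C ((U : Matrix C₁ C₁ ℂ) R R) * f * g))
    (hg : g = PowerSeries.X * (PowerSeries.C ((U : Matrix C₁ C₁ ℂ) L L) +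
      PowerSeries.C ((U : Matrix C₁ C₁ ℂ) R L) * f * g)) (t j : ℕ) (τ : C₁) :
    amplitude U boundary (ket ((j : ℤ) + 1, τ)) (0, L) (t + 1) =
      PowerSeries.coeff (t + 1) ((if τ = R then f else g) * g ^ j) := by
  have key : ∀ (j : ℕ) (τ : C₁), (if τ = R then f else g) * g ^ j =
      PowerSeries.X * (PowerSeries.C ((U : Matrix C₁ C₁ ℂ) L τ) * g ^ j +
        PowerSeries.C ((U : Matrix C₁ C₁ ℂ) R τ) * (f * g ^ (j + 1))) := fun j τ => by
    rcases eq_R_or_eq_L τ with rfl | rfl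
    · rw [if_pos rfl]
      linear_combination g ^ j * hf
    · rw [if_neg (by decide)]
      linear_combination g ^ j * hg
  have hf0 : PowerSeries.constantCoeff f = 0 := by rw [hf]; simp
  have hg0 : PowerSeries.constantCoeff g = 0 := by rw [hg]; simp
  induction t generalizing j τ with
  | zero =>
    have h1 : (0 : ℤ) ≠ j + 1 + 1 := by omega
    have h2 : L ≠ R := by decide
    rw [key, PowerSeries.coeff_succ_X_mul, map_add, PowerSeries.coeff_C_mul,
      PowerSeries.coeff_C_mul, zero_add, amplitude_one, walk_ket, lp.coeFn_add, Pi.add_apply,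
      lp.coeFn_smul, lp.coeFn_smul, Pi.smul_apply, Pi.smul_apply, ket_apply, ket_apply]
    cases j with
    | zero => simp [h2, hf0]
    | succ j =>
      have h3 : (0 : ℤ) ≠ ((j + 1 : ℕ) : ℤ) + 1 - 1 := by omega
      simp only [Prod.mk.injEq, h2, h3]
      simp [hf0, hg0]
  | succ t ih =>
    rw [key, PowerSeries.coeff_succ_X_mul, map_add, PowerSeries.coeff_C_mul,
      PowerSeries.coeff_C_mul, amplitude_succ, absorbingWalk_ket, amplitude_add, amplitude_smul,
      amplitude_smul, ih, if_pos rfl]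
    cases j with
    -- From height 1 the left-moving component is removed; correspondingly g ^ 0 = 1 has no
    -- coefficient in positive degree.
    | zero => simp [amplitude_zero, PowerSeries.coeff_one]
    | succ j =>
      rw [if_neg j.succ_ne_zero, Nat.cast_succ, ih, if_neg (by decide), ← pow_succ', add_comm]

theorem semiInfiniteAt_one (U : Matrix.unitaryGroup C₁ ℂ) {f g : PowerSeries ℂ}
    (hf : f = PowerSeries.X * (PowerSeries.C ((U : Matrix C₁ C₁ ℂ) L R) +
      PowerSeries.C ((U : Matrix C₁ C₁ ℂ) R R) * f * g))
    (hg : g = PowerSeries.X * (PowerSeries.C ((U : Matrix C₁ C₁ ℂ) L L) +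
      PowerSeries.C ((U : Matrix C₁ C₁ ℂ) R L) * f * g)) (t : ℕ) :
    semiInfiniteAt U 1 1 0 (t + 1) = ‖PowerSeries.coeff (t + 1) f‖ ^ 2 := by
  have hinit : initial 1 1 0 = ket (((0 : ℕ) : ℤ) + 1, R) := by simp [initial]
  rw [semiInfiniteAt, absorptionAt, hinit,
    tsum_eq_single (⟨((0 : ℤ), L), rfl⟩ : boundary) fun b hb => ?_]
  · rw [amplitude_ket_zero_L U hf hg, if_pos rfl, pow_zero, mul_one]
  · obtain ⟨⟨m, σ⟩, hm⟩ := b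
    obtain rfl : m = 0 := hm
    rcases eq_R_or_eq_L σ with rfl | rfl
    · rw [amplitude_ket_zero_R, norm_zero, zero_pow two_ne_zero]
    · exact absurd rfl hb

/-! ### Unitarity and evaluation of the probability -/

theorem unitary_relations (U : Matrix.unitaryGroup C₁ ℂ)
    (hb : (U : Matrix C₁ C₁ ℂ) R L ≠ 0) :
    ‖(U : Matrix C₁ C₁ ℂ) R R‖ ^ 2 + ‖(U : Matrix C₁ C₁ ℂ) R L‖ ^ 2 = 1 ∧
      ‖(U : Matrix C₁ C₁ ℂ) L R‖ ^ 2 = ‖(U : Matrix C₁ C₁ ℂ) R L‖ ^ 2 ∧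
      ∃ Δ : ℂ, ‖Δ‖ = 1 ∧
        (U : Matrix C₁ C₁ ℂ) R R * (U : Matrix C₁ C₁ ℂ) L L -
          (U : Matrix C₁ C₁ ℂ) R L * (U : Matrix C₁ C₁ ℂ) L R = Δ ∧
        (U : Matrix C₁ C₁ ℂ) R L * (U : Matrix C₁ C₁ ℂ) L R =
          -(Δ * (‖(U : Matrix C₁ C₁ ℂ) R L‖ ^ 2 : ℝ)) := by
  have h1 := Matrix.mem_unitaryGroup_iff.1 U.2
  have h2 := Matrix.mem_unitaryGroup_iff'.1 U.2
  have hRR := congrFun (congrFun h1 R) R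
  have hLR := congrFun (congrFun h1 L) R
  have hRR' := congrFun (congrFun h2 R) R
  rw [Matrix.mul_apply, sum_C₁, Matrix.one_apply] at hRR hLR hRR'
  simp only [Matrix.star_apply, show L ≠ R by decide, if_true, if_false, RCLike.star_def]
    at hRR hLR hRR'
  set a := (U : Matrix C₁ C₁ ℂ) R R
  set b := (U : Matrix C₁ C₁ ℂ) R L
  set c := (U : Matrix C₁ C₁ ℂ) L R
  set d := (U : Matrix C₁ C₁ ℂ) L L
  have hab : ‖a‖ ^ 2 + ‖b‖ ^ 2 = 1 := by
    rw [Complex.mul_conj', Complex.mul_conj'] at hRR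
    exact_mod_cast hRR
  have hac : ‖a‖ ^ 2 + ‖c‖ ^ 2 = 1 := by
    rw [Complex.conj_mul', Complex.conj_mul'] at hRR'
    exact_mod_cast hRR'
  have hcb : ‖c‖ ^ 2 = ‖b‖ ^ 2 := by linarith
  -- Orthogonality of the rows gives c = -Δ b̄. As |c| = |b| ≠ 0, this forces |Δ| = 1, and
  -- multiplying by b gives bc = -Δ|b|².
  have hc : c = -((a * d - b * c) * (starRingEnd ℂ) b) := by
    linear_combination a * hLR - c * hRR
  refine ⟨hab, hcb, a * d - b * c, ?_, rfl, ?_⟩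
  · have h := congrArg norm hc
    rw [norm_neg, norm_mul, Complex.norm_conj,
      (pow_left_inj₀ (norm_nonneg _) (norm_nonneg _) two_ne_zero).1 hcb] at h
    exact (mul_eq_right₀ (norm_ne_zero_iff.2 hb)).1 h.symm
  · rw [Complex.ofReal_pow, ← Complex.mul_conj']
    linear_combination b * hc

theorem hasSum_semiInfiniteAt_one (U : Matrix.unitaryGroup C₁ ℂ)
    (hb : (U : Matrix C₁ C₁ ℂ) R L ≠ 0) {β : ℝ} (hβ : ‖(U : Matrix C₁ C₁ ℂ) R L‖ ^ 2 = β) :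
    HasSum (fun t : ℕ => semiInfiniteAt U 1 1 0 (t + 1))
      ((√(1 - (1 - 2 * β) ^ 2) - (1 - 2 * β) * Real.arccos (1 - 2 * β)) / (Real.pi * β)) := by
  obtain ⟨hab, hcb, Δ, hΔ1, hΔ, hbc⟩ := unitary_relations U hb
  rw [hβ] at hbc hab hcb
  obtain ⟨f, g, hf, hg, hodd, heven⟩ := exists_arrival_series hΔ hbc
  have hβ0 : 0 < β := hβ ▸ pow_pos (norm_pos_iff.2 hb) 2
  have hβ1 : β ≤ 1 := by nlinarith [sq_nonneg ‖(U : Matrix C₁ C₁ ℂ) R R‖]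
  rw [← add_zero (_ / _)]
  refine HasSum.even_add_odd ((hasSum_sq_returnCoeff hβ0 hβ1).congr_fun fun n => ?_)
    (hasSum_zero.congr_fun fun n => ?_)
  · rw [semiInfiniteAt_one U hf hg, heven, norm_mul, norm_mul, norm_pow, hΔ1, one_pow, mul_one,
      mul_pow, hcb, Complex.norm_real, Real.norm_eq_abs, sq_abs]
  · rw [semiInfiniteAt_one U hf hg, show 2 * n + 1 + 1 = 2 * (n + 1) by ring, hodd, norm_zero,
      zero_pow two_ne_zero]

theorem return_probability_trig {φ : ℝ} (h0 : 0 ≤ φ) (h1 : φ ≤ Real.pi / 2) :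
    (√(1 - (1 - 2 * Real.sin φ ^ 2) ^ 2) - (1 - 2 * Real.sin φ ^ 2) *
      Real.arccos (1 - 2 * Real.sin φ ^ 2)) / (Real.pi * Real.sin φ ^ 2) =
      (Real.sin (2 * φ) - 2 * φ * Real.cos (2 * φ)) / (Real.pi * Real.sin φ ^ 2) := by
  -- With |b| = sin φ, the parameter x becomes cos 2φ, so its arccosine is 2φ.
  have hx : 1 - 2 * Real.sin φ ^ 2 = Real.cos (2 * φ) := by
    rw [Real.cos_two_mul, Real.cos_sq']
    ring
  rw [hx, Real.arccos_cos (by linarith) (by linarith), ← Real.sin_sq,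
    Real.sqrt_sq (Real.sin_nonneg_of_nonneg_of_le_pi (by linarith) (by linarith)),
    mul_comm (Real.cos (2 * φ))]

end QuantumWalk

/-- The entries `a = U R R` and `b = U R L` form the first row of the coin matrix in the basis
`|R⟩, |L⟩`; in particular `U` may be the matrix with rows `(a, b)` and `(-conj b, conj a)`. -/
theorem theorem4p1 (U : Matrix.unitaryGroup QuantumWalk.C₁ ℂ) (a b : ℂ)
    (ha : (U : Matrix QuantumWalk.C₁ QuantumWalk.C₁ ℂ) QuantumWalk.R QuantumWalk.R = a)
    (hb : (U : Matrix QuantumWalk.C₁ QuantumWalk.C₁ ℂ) QuantumWalk.R QuantumWalk.L = b)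
    (hb0 : b ≠ 0) :
    (Summable fun t : ℕ => QuantumWalk.semiInfiniteAt U 1 1 0 (t + 1)) ∧
    QuantumWalk.semiInfiniteProb U 1 1 0 =
      2 / (Real.pi * ‖b‖ ^ 2) *
        ((‖b‖ ^ 2 - ‖a‖ ^ 2) * Real.arccos ‖a‖ + ‖a‖ * ‖b‖) ∧
    ∀ φ ∈ Set.Icc (0 : ℝ) (Real.pi / 2), ‖a‖ = Real.cos φ →
      QuantumWalk.semiInfiniteProb U 1 1 0 =
        (Real.sin (2 * φ) - 2 * φ * Real.cos (2 * φ)) / (Real.pi * Real.sin φ ^ 2) := by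
  have hsum := QuantumWalk.hasSum_semiInfiniteAt_one U (by rwa [hb]) rfl
  have hab := (QuantumWalk.unitary_relations U (by rwa [hb])).1
  rw [ha, hb] at hab
  rw [hb] at hsum
  have hφ : ∀ φ ∈ Set.Icc (0 : ℝ) (Real.pi / 2), ‖a‖ = Real.cos φ →
      ‖b‖ = Real.sin φ ∧ QuantumWalk.semiInfiniteProb U 1 1 0 =
        (Real.sin (2 * φ) - 2 * φ * Real.cos (2 * φ)) / (Real.pi * Real.sin φ ^ 2) := by
    intro φ hφ hcos
    have hs : 0 ≤ Real.sin φ :=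
      Real.sin_nonneg_of_nonneg_of_le_pi hφ.1 (by linarith [hφ.2, Real.pi_pos])
    have hbs : ‖b‖ = Real.sin φ := by
      rw [← pow_left_inj₀ (norm_nonneg _) hs two_ne_zero, Real.sin_sq, ← hcos]
      linarith
    rw [hbs, QuantumWalk.return_probability_trig hφ.1 hφ.2] at hsum
    exact ⟨hbs, hsum.tsum_eq⟩
  refine ⟨hsum.summable, ?_, fun φ h hcos => (hφ φ h hcos).2⟩
  have ha1 : ‖a‖ ≤ 1 := by nlinarith [norm_nonneg a, sq_nonneg ‖b‖]
  -- The closed form in |a| and |b| is the trigonometric form at φ = arccos |a|.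
  have hcos : ‖a‖ = Real.cos (Real.arccos ‖a‖) :=
    (Real.cos_arccos (by linarith [norm_nonneg a]) ha1).symm
  obtain ⟨hbs, hP⟩ := hφ (Real.arccos ‖a‖)
    ⟨Real.arccos_nonneg _, Real.arccos_le_pi_div_two.2 (norm_nonneg a)⟩ hcos
  have hb1 : ‖b‖ ≠ 0 := norm_ne_zero_iff.2 hb0
  rw [hP, Real.sin_two_mul, Real.cos_two_mul, ← hcos, ← hbs]
  have hπ := Real.pi_ne_zero
  field_simp
  linear_combination (-Real.arccos ‖a‖) * hab
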